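/- Let $X$ be a non-empty compact metric space and let $\mathcal{K}(X)$ be the set of non-empty compact subsets of $X$, equipped with the Hausdorff metric. For $E\subseteq X$ and $r>0$ let $N(E,r)$ be the minimal number of closed balls of radius $r$ (with centres in $X$) needed to cover $E$, and for $F\in\mathcal{K}(X)$ let the lower dimension of $F$ be $$\dim_{\mathrm L}F=\sup\Big\{\alpha\in\mathbb{R} : (\exists C>0)(\exists\rho>0)(\forall\, 0<r<R\le\rho)(\forall x\in F)\ \ N\big(\overline{B}(x,R)\cap F,r\big)\ge C\Big(\frac Rr\Big)^{\alpha}\Big\}\in[0,\infty],$$ where $\overline{B}(x,R)$ is the closed ball with centre $x$ and radius $R$. A function between metrizable spaces is of Baire class $0$ if it is continuous, and of Baire class $n+1$ if it is a pointwise limit of a sequence of functions of Baire class $n$. Then the function $F\mapsto\dim_{\mathrm L}F$ from $\mathcal{K}(X)$ to the extended real line $[-\infty,\infty]$ (with its usual topology) is of Baire class $2$. Moreover, if $\dim_{\mathrm L}F<\infty$ for every $F\in\mathcal{K}(X)$, then $F\mapsto\dim_{\mathrm L}F$ is of Baire class $2$ as a function from $\mathcal{K}(X)$ to $\mathbb{R}$.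 -/

import Mathlib

open Filter Topology TopologicalSpace
open scoped ENNReal

/-- The lower dimension `dim_L F` of a subset `F` of a metric space `X`: the supremum, in the extended
reals, of the real exponents `α` for which there are `C > 0` and `ρ > 0` such that for all
`0 < r < R ≤ ρ` and all `x ∈ F` one has `N(B(x, R) ∩ F, r) ≥ C (R / r) ^ α`. Here `N(E, r)` is the
minimal number of balls of radius `r` (with centres anywhere in `X`) needed to cover `E`.
For nonempty `F` every `α ≤ 0` is admissible, so the value lies in `[0, ∞]`. -/
noncomputable def lowerDimension {X : Type*} [MetricSpace X] (F : Set X) : EReal :=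
  sSup {a : EReal | ∃ α : ℝ, a = (α : EReal) ∧
    ∃ C : ℝ, 0 < C ∧ ∃ ρ : ℝ, 0 < ρ ∧
      ∀ r R : ℝ, 0 < r → r < R → R ≤ ρ → ∀ x ∈ F,
        ENNReal.ofReal (C * (R / r) ^ α) ≤
          ((Metric.externalCoveringNumber r.toNNReal (Metric.closedBall x R ∩ F) : ℕ∞) : ℝ≥0∞)}

/-- The finite levels of the Baire hierarchy: a function is of Baire class `0` if it is continuous,
and of Baire class `n + 1` if it is a pointwise limit of a sequence of functions of Baire
class `n`. -/
def IsBaireClass {A B : Type*} [TopologicalSpace A] [TopologicalSpace B] : ℕ → (A → B) → Prop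
  | 0, f => Continuous f
  | n + 1, f => ∃ g : ℕ → A → B, (∀ k, IsBaireClass n (g k)) ∧
      ∀ x, Tendsto (fun k => g k x) atTop (𝓝 (f x))

open scoped NNReal

/-
For fixed rational `q` and natural `m`, the sets `F` whose covering numbers satisfy the estimate in
the definition of `dim_L` with exponent `q` and `C = ρ = 1 / (m + 1)` form a closed family: if `G`
is `δ`-close to `F`, then enlarging by `δ` the balls that cover the part of `F` in a ball covers the
part of `G` in the ball shrunk by `2δ`, and `δ → 0` loses nothing. The indicator of a closed set is
of Baire class `1`, and `dim_L` is the countable supremum of the functions with value `q` on the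
`(q, m)`-th family and `0` off it. The partial suprema of these functions are real-valued, of Baire
class `1`, and increase to `dim_L`.
-/

section BaireClass

variable {A B D : Type*} [TopologicalSpace A] [TopologicalSpace B] [TopologicalSpace D]

theorem IsBaireClass.continuous_comp {g : B → D} (hg : Continuous g) :
    ∀ {n : ℕ} {f : A → B}, IsBaireClass n f → IsBaireClass n (fun x => g (f x))
  | 0, _, hf => hg.comp hf
  | _ + 1, _, ⟨u, hu, hlim⟩ =>
    ⟨fun k x => g (u k x), fun k => (hu k).continuous_comp hg,
      fun x => (hg.tendsto _).comp (hlim x)⟩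

protected theorem IsBaireClass.partialSups [SemilatticeSup B] [ContinuousSup B] (k : ℕ) :
    ∀ {n : ℕ} {f : ℕ → A → B}, (∀ i, IsBaireClass n (f i)) → IsBaireClass n (partialSups f k)
  | 0, _, hf => Continuous.partialSups fun i _ => hf i
  | _ + 1, f, hf => by
    choose u hu hlim using hf
    refine ⟨fun j => partialSups (fun i => u i j) k, fun j => .partialSups k fun i => hu i j,
      fun x => ?_⟩
    simp only [Pi.partialSups_apply]
    exact Tendsto.partialSups_apply fun i _ => hlim i x

end BaireClass

theorem isBaireClass_one_indicator_const {A E : Type*} [PseudoEMetricSpace A] [Zero E]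
    [MulActionWithZero ℝ≥0 E] [TopologicalSpace E] [ContinuousSMul ℝ≥0 E] {S : Set A}
    (hS : IsClosed S) (c : E) : IsBaireClass 1 (S.indicator fun _ => c) := by
  have hpos (k : ℕ) : (0 : ℝ) < 1 / ((k : ℝ) + 1) := Nat.one_div_pos_of_nat
  have hone : IsBaireClass 1 (S.indicator fun _ => (1 : ℝ≥0)) := by
    refine ⟨fun k => thickenedIndicator (hpos k) S, fun k => (thickenedIndicator _ S).continuous,
      tendsto_pi_nhds.1 ?_⟩
    simpa only [hS.closure_eq] using
      thickenedIndicator_tendsto_indicator_closure hpos tendsto_one_div_add_atTop_nhds_zero_nat S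
  have hsmul : (S.indicator fun _ => c) = fun x => S.indicator (fun _ => (1 : ℝ≥0)) x • c := by
    ext x
    by_cases hx : x ∈ S <;> simp [hx]
  rw [hsmul]
  exact hone.continuous_comp (continuous_id.smul continuous_const)

theorem tendsto_comp_partialSups {B L : Type*} [LinearOrder B] [CompleteLattice L]
    [TopologicalSpace L] [SupConvergenceClass L] {φ : B → L} (hφ : Monotone φ) (u : ℕ → B) :
    Tendsto (fun k => φ (partialSups u k)) atTop (𝓝 (⨆ i, φ (u i))) := by
  refine tendsto_atTop_isLUB (hφ.comp (partialSups_monotone u)) ⟨?_, fun b hb => ?_⟩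
  · rintro _ ⟨k, rfl⟩
    obtain ⟨i, -, hi⟩ := exists_partialSups_eq u k
    exact (congrArg φ hi).trans_le (le_iSup (fun i => φ (u i)) i)
  · exact iSup_le fun i => (hφ (le_partialSups u i)).trans (hb ⟨i, rfl⟩)

section LowerCoveringBound

variable {X : Type*} [PseudoMetricSpace X] {α C ρ : ℝ} {F G : Set X}

/-- The estimate in the definition of `lowerDimension`, with exponent `α` and constants `C`, `ρ`:
`N(B(x, R) ∩ F, r) ≥ C (R / r) ^ α` for all `0 < r < R ≤ ρ` and `x ∈ F`. -/
def HasLowerCoveringBound (α C ρ : ℝ) (F : Set X) : Prop :=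
  ∀ r R : ℝ, 0 < r → r < R → R ≤ ρ → ∀ x ∈ F,
    ENNReal.ofReal (C * (R / r) ^ α) ≤
      ((Metric.externalCoveringNumber r.toNNReal (Metric.closedBall x R ∩ F) : ℕ∞) : ℝ≥0∞)

theorem HasLowerCoveringBound.mono {α' C' ρ' : ℝ} (h : HasLowerCoveringBound α C ρ F)
    (hα : α' ≤ α) (hC : C' ≤ C) (hC0 : 0 ≤ C) (hρ : ρ' ≤ ρ) :
    HasLowerCoveringBound α' C' ρ' F := by
  intro r R hr hrR hR x hx
  refine (ENNReal.ofReal_le_ofReal ?_).trans (h r R hr hrR (hR.trans hρ) x hx)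
  have hRr : 1 ≤ R / r := (one_le_div hr).2 hrR.le
  gcongr

theorem hasLowerCoveringBound_zero_one (ρ : ℝ) (F : Set X) : HasLowerCoveringBound 0 1 ρ F := by
  intro r R hr hrR _ x hx
  have hne : (Metric.closedBall x R ∩ F).Nonempty :=
    ⟨x, Metric.mem_closedBall_self (hr.trans hrR).le, hx⟩
  have hone := Order.one_le_iff_pos.2
    (Metric.externalCoveringNumber_pos_iff (ε := r.toNNReal).2 hne)
  rw [Real.rpow_zero, mul_one, ENNReal.ofReal_one]
  exact_mod_cast hone

theorem externalCoveringNumber_le_of_hausdorffEDist_lt {r δ : ℝ≥0} {R : ℝ}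
    (hFG : Metric.hausdorffEDist F G < δ) {x y : X} (hxy : dist x y ≤ δ) :
    Metric.externalCoveringNumber (r + δ) (Metric.closedBall y (R - 2 * δ) ∩ G) ≤
      Metric.externalCoveringNumber r (Metric.closedBall x R ∩ F) := by
  refine le_iInf₂ fun N hN => Metric.IsCover.externalCoveringNumber_le_encard ?_
  rintro z ⟨hzy, hzG⟩
  obtain ⟨w, hwF, hzw⟩ := Metric.exists_edist_lt_of_hausdorffEDist_lt hzG
    (Metric.hausdorffEDist_comm.trans_lt hFG)
  have hwx : w ∈ Metric.closedBall x R := by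
    have hzw' : dist w z < δ := dist_comm w z ▸ edist_lt_coe.1 hzw
    rw [Metric.mem_closedBall] at hzy ⊢
    linarith [dist_triangle4 w z y x, dist_comm x y]
  obtain ⟨c, hcN, hwc⟩ := hN ⟨hwx, hwF⟩
  refine ⟨c, hcN, ?_⟩
  calc edist z c ≤ edist z w + edist w c := edist_triangle z w c
    _ ≤ δ + r := add_le_add hzw.le hwc
    _ = ↑(r + δ) := by rw [add_comm, ENNReal.coe_add]

theorem HasLowerCoveringBound.ofReal_le_of_hausdorffEDist_lt (hG : HasLowerCoveringBound α C ρ G)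
    {r δ : ℝ≥0} {R : ℝ} (hr : 0 < r) (hδ : r + δ < R - 2 * δ) (hR : R ≤ ρ)
    (hFG : Metric.hausdorffEDist F G < δ) {x : X} (hx : x ∈ F) :
    ENNReal.ofReal (C * ((R - 2 * δ) / (r + δ)) ^ α) ≤
      ((Metric.externalCoveringNumber r (Metric.closedBall x R ∩ F) : ℕ∞) : ℝ≥0∞) := by
  obtain ⟨y, hy, hxy⟩ := Metric.exists_edist_lt_of_hausdorffEDist_lt hx hFG
  have hcover := externalCoveringNumber_le_of_hausdorffEDist_lt (r := r) (R := R) hFG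
    (edist_lt_coe.1 hxy).le
  have hbound := hG (r + δ : ℝ≥0) (R - 2 * δ) (by positivity) (by exact_mod_cast hδ)
    (by linarith [δ.coe_nonneg]) y hy
  rw [Real.toNNReal_coe, NNReal.coe_add] at hbound
  exact hbound.trans (by exact_mod_cast hcover)

theorem hasLowerCoveringBound_of_forall_hausdorffEDist_lt
    (h : ∀ ε : ℝ≥0∞, 0 < ε → ∃ G : Set X,
      Metric.hausdorffEDist F G < ε ∧ HasLowerCoveringBound α C ρ G) :
    HasLowerCoveringBound α C ρ F := by
  intro r R hr hrR hR x hx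
  lift r to ℝ≥0 using hr.le
  rw [Real.toNNReal_coe]
  have hlim : Tendsto (fun δ : ℝ≥0 => ENNReal.ofReal (C * ((R - 2 * δ) / (r + δ)) ^ α)) (𝓝[>] 0)
      (𝓝 (ENNReal.ofReal (C * (R / r) ^ α))) := by
    have hcont : ContinuousAt (fun δ : ℝ≥0 => C * ((R - 2 * δ) / (r + δ)) ^ α) 0 := by
      refine continuousAt_const.mul (ContinuousAt.rpow_const (.div ?_ ?_ ?_) (.inl ?_))
      · fun_prop
      · fun_prop
      · simpa using hr.ne'
      · simpa using ⟨(hr.trans hrR).ne', NNReal.coe_pos.1 hr |>.ne'⟩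
    simpa using ENNReal.tendsto_ofReal (hcont.tendsto.mono_left nhdsWithin_le_nhds)
  have hsmall : ∀ᶠ δ : ℝ≥0 in 𝓝[>] 0, (r + δ : ℝ) < R - 2 * δ := by
    refine nhdsWithin_le_nhds (ContinuousAt.eventually_lt ?_ ?_ (by simpa using hrR)) <;> fun_prop
  refine le_of_tendsto hlim ?_
  filter_upwards [hsmall, self_mem_nhdsWithin] with δ hδ hδ0
  obtain ⟨G, hFG, hG⟩ := h δ (ENNReal.coe_pos.2 hδ0)
  exact hG.ofReal_le_of_hausdorffEDist_lt hr hδ hR hFG hx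

end LowerCoveringBound

section LowerDimension

variable {X : Type*} [MetricSpace X]

theorem isClosed_setOf_hasLowerCoveringBound (α C ρ : ℝ) :
    IsClosed {F : NonemptyCompacts X | HasLowerCoveringBound α C ρ (F : Set X)} := by
  refine isClosed_of_closure_subset fun F hF =>
    hasLowerCoveringBound_of_forall_hausdorffEDist_lt fun ε hε => ?_
  obtain ⟨G, hG, hFG⟩ := EMetric.mem_closure_iff.1 hF ε hε
  exact ⟨G, hFG, hG⟩

theorem HasLowerCoveringBound.le_lowerDimension {α C ρ : ℝ} {F : Set X}
    (h : HasLowerCoveringBound α C ρ F) (hC : 0 < C) (hρ : 0 < ρ) :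
    (α : EReal) ≤ lowerDimension F :=
  le_sSup ⟨α, rfl, C, hC, ρ, hρ, h⟩

theorem lowerDimension_nonneg (F : Set X) : 0 ≤ lowerDimension F :=
  (hasLowerCoveringBound_zero_one 1 F).le_lowerDimension one_pos one_pos

theorem exists_rat_nat_hasLowerCoveringBound_of_lt {F : Set X} {b : EReal}
    (hb : b < lowerDimension F) :
    ∃ (q : ℚ) (m : ℕ), b < (q : ℝ) ∧ HasLowerCoveringBound q (1 / (m + 1)) (1 / (m + 1)) F := by
  obtain ⟨_, ⟨α, rfl, C, hC, ρ, hρ, h⟩, hbα⟩ := lt_sSup_iff.1 hb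
  obtain ⟨q, hbq, hqα⟩ := EReal.exists_rat_btwn_of_lt hbα
  obtain ⟨m, hm⟩ := exists_nat_one_div_lt (lt_min hC hρ)
  exact ⟨q, m, hbq, HasLowerCoveringBound.mono h (EReal.coe_le_coe_iff.1 hqα.le)
    (hm.le.trans (min_le_left _ _)) hC.le (hm.le.trans (min_le_right _ _))⟩

/-- The real number `q` if `F` satisfies the covering estimate with exponent `q` and constants
`C = ρ = 1 / (m + 1)`, and `0` otherwise, where `p = (q, m)`. The lower dimension is the supremum
of these over the countably many `p`. -/
noncomputable def lowerDimensionApprox (p : ℚ × ℕ) : NonemptyCompacts X → ℝ :=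
  {F : NonemptyCompacts X |
    HasLowerCoveringBound p.1 (1 / (p.2 + 1)) (1 / (p.2 + 1)) (F : Set X)}.indicator fun _ => p.1

theorem isBaireClass_one_lowerDimensionApprox (p : ℚ × ℕ) :
    IsBaireClass 1 (lowerDimensionApprox (X := X) p) :=
  isBaireClass_one_indicator_const (isClosed_setOf_hasLowerCoveringBound _ _ _) _

theorem iSup_lowerDimensionApprox (F : NonemptyCompacts X) :
    ⨆ p, (lowerDimensionApprox p F : EReal) = lowerDimension (F : Set X) := by
  refine le_antisymm (iSup_le fun p => ?_) (le_of_forall_lt fun b hb => ?_)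
  · by_cases hF : HasLowerCoveringBound p.1 (1 / (p.2 + 1)) (1 / (p.2 + 1)) (F : Set X)
    · have hp : lowerDimensionApprox p F = p.1 := Set.indicator_of_mem hF _
      exact hp ▸ hF.le_lowerDimension (by positivity) (by positivity)
    · have hp : lowerDimensionApprox p F = 0 := Set.indicator_of_notMem hF _
      exact hp ▸ lowerDimension_nonneg (F : Set X)
  · obtain ⟨q, m, hbq, hF⟩ := exists_rat_nat_hasLowerCoveringBound_of_lt hb
    have hq : lowerDimensionApprox (q, m) F = q := Set.indicator_of_mem hF _
    exact (hq ▸ hbq).trans_le (le_iSup (fun p => (lowerDimensionApprox p F : EReal)) (q, m))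

theorem exists_isBaireClass_one_tendsto_lowerDimension (X : Type*) [MetricSpace X] :
    ∃ g : ℕ → NonemptyCompacts X → ℝ, (∀ k, IsBaireClass 1 (g k)) ∧
      ∀ F : NonemptyCompacts X,
        Tendsto (fun k => (g k F : EReal)) atTop (𝓝 (lowerDimension (F : Set X))) := by
  obtain ⟨e, he⟩ := exists_surjective_nat (ℚ × ℕ)
  refine ⟨partialSups fun i => lowerDimensionApprox (e i),
    fun k => .partialSups k fun i => isBaireClass_one_lowerDimensionApprox (e i), fun F => ?_⟩
  rw [← iSup_lowerDimensionApprox, ← he.iSup_comp]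
  simpa only [Pi.partialSups_apply] using
    tendsto_comp_partialSups EReal.coe_strictMono.monotone fun i => lowerDimensionApprox (e i) F

end LowerDimension

theorem theorem5p3_general {X : Type*} [MetricSpace X] :
    IsBaireClass 2 (fun F : NonemptyCompacts X => lowerDimension (F : Set X)) ∧
    ((∀ F : NonemptyCompacts X, lowerDimension (F : Set X) ≠ ⊤) →
      IsBaireClass 2 (fun F : NonemptyCompacts X => (lowerDimension (F : Set X)).toReal)) := by
  obtain ⟨g, hg, hlim⟩ := exists_isBaireClass_one_tendsto_lowerDimension X
  refine ⟨⟨fun k F => g k F, fun k => (hg k).continuous_comp continuous_coe_real_ereal, hlim⟩,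
    fun hfin => ⟨g, hg, fun F => ?_⟩⟩
  have hbot : lowerDimension (F : Set X) ≠ ⊥ :=
    (EReal.bot_lt_zero.trans_le (lowerDimension_nonneg _)).ne'
  exact (EReal.tendsto_toReal (hfin F) hbot).comp (hlim F)

theorem theorem5p3 {X : Type*} [MetricSpace X] [CompactSpace X] [Nonempty X] :
    IsBaireClass 2 (fun F : NonemptyCompacts X => lowerDimension (F : Set X)) ∧
    ((∀ F : NonemptyCompacts X, lowerDimension (F : Set X) ≠ ⊤) →
      IsBaireClass 2 (fun F : NonemptyCompacts X => (lowerDimension (F : Set X)).toReal)) :=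
  theorem5p3_general
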